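/- Let $\mathbb{T}$ be the unit circle with its normalized Haar measure. For a complex Banach space $X$ let $L^1(\mathbb{T};X)$ be the Banach space of (classes of) strongly measurable, Bochner integrable functions $\mathbb{T}\to X$, and let $\widetilde H^1(X)$ be the closure in $L^1(\mathbb{T};X)$ of the set of $X$-valued analytic polynomials $\sum_{k=0}^n e^{ik\theta}x_k$ ($n\in\mathbb{N}$, $x_k\in X$). Write $H^1=\widetilde H^1(\mathbb{C})$. Let $H^1\hat\otimes X$ be the projective tensor product, that is, the completion of the algebraic tensor product $H^1\otimes X$ for the norm $$\|u\|_\wedge=\inf\Big\{\sum_{k}\|h_k\|\,\|x_k\| : u=\sum_{k}h_k\otimes x_k \text{ (finite sum)}\Big\},$$ and let $J_X: H^1\hat\otimes X\to\widetilde H^1(X)$ be the canonical norm-decreasing linear map determined by $J_X(h\otimes x)(\theta)=h(\theta)\,x$. The space $X$ is called $H^1$-projective if $J_X$ is surjective. The $H^1$-projectivity constant $\eta(X)\in[0,\infty]$ is the smallest $c\ge 0$ such that $$\|F\|_{H^1\hat\otimes X}\le c\,\|J_XF\|_{\widetilde H^1(X)}\qquad\text{for all }F\in H^1\hat\otimes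 X,$$ with $\eta(X)=\infty$ if there is no such $c$. **Corollary 2.6.** Let $X$ be a complex Banach space with bidual $X^{**}$. Then $X$ is $H^1$-projective if and only if $X^{**}$ is $H^1$-projective. Moreover, $\eta(X)=\eta(X^{**})$. -/

import Mathlib

open MeasureTheory Real
open scoped TensorProduct NNReal ENNReal

/-! ### Projective tensor product of two complex Banach spaces -/

/-- The algebraic tensor product `E ⊗ F`, as a type to be equipped with the projective norm. -/
def ProjAlg (E F : Type*) [NormedAddCommGroup E] [NormedSpace ℂ E]
    [NormedAddCommGroup F] [NormedSpace ℂ F] : Type _ := E ⊗[ℂ] F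

namespace ProjAlg

variable {E F : Type*} [NormedAddCommGroup E] [NormedSpace ℂ E]
  [NormedAddCommGroup F] [NormedSpace ℂ F]

noncomputable instance : AddCommGroup (ProjAlg E F) :=
  inferInstanceAs (AddCommGroup (E ⊗[ℂ] F))

noncomputable instance : Module ℂ (ProjAlg E F) :=
  inferInstanceAs (Module ℂ (E ⊗[ℂ] F))

/-- The elementary tensor `x ⊗ y`. -/
noncomputable def tmul (x : E) (y : F) : ProjAlg E F := (x ⊗ₜ[ℂ] y : E ⊗[ℂ] F)

/-- The values `∑ ‖x k‖ * ‖y k‖` over all representations `u = ∑ x k ⊗ y k`. -/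
def costs (u : ProjAlg E F) : Set ℝ :=
  {r | ∃ (n : ℕ) (x : Fin n → E) (y : Fin n → F),
    u = ∑ k, tmul (x k) (y k) ∧ r = ∑ k, ‖x k‖ * ‖y k‖}

/-- The projective norm: the infimum of `∑ ‖x k‖ * ‖y k‖` over all representations of `u`. -/
noncomputable instance : Norm (ProjAlg E F) := ⟨fun u => sInf (costs u)⟩

theorem norm_def (u : ProjAlg E F) : ‖u‖ = sInf (costs u) := rfl

theorem costs_nonneg {u : ProjAlg E F} {r : ℝ} (hr : r ∈ costs u) : 0 ≤ r := by
  obtain ⟨n, x, y, -, rfl⟩ := hr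
  positivity

theorem costs_bddBelow (u : ProjAlg E F) : BddBelow (costs u) :=
  ⟨0, fun _ hr => costs_nonneg hr⟩

theorem costs_add {u v : ProjAlg E F} {r s : ℝ} (hr : r ∈ costs u) (hs : s ∈ costs v) :
    r + s ∈ costs (u + v) := by
  obtain ⟨n, x, y, rfl, rfl⟩ := hr
  obtain ⟨m, x', y', rfl, rfl⟩ := hs
  refine ⟨n + m, Fin.append x x', Fin.append y y', ?_, ?_⟩ <;>
    simp [Fin.sum_univ_add]

theorem costs_smul (a : ℂ) {u : ProjAlg E F} {r : ℝ} (hr : r ∈ costs u) :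
    ‖a‖ * r ∈ costs (a • u) := by
  obtain ⟨n, x, y, rfl, rfl⟩ := hr
  refine ⟨n, fun k => a • x k, y, ?_, ?_⟩
  · rw [Finset.smul_sum]
    exact Finset.sum_congr rfl fun k _ => TensorProduct.smul_tmul' a (x k) (y k)
  · rw [Finset.mul_sum]
    exact Finset.sum_congr rfl fun k _ => by rw [norm_smul, mul_assoc]

theorem costs_nonempty (u : ProjAlg E F) : (costs u).Nonempty := by
  refine TensorProduct.induction_on (motive := fun u : E ⊗[ℂ] F =>
    (costs (E := E) (F := F) u).Nonempty) u ?_ ?_ ?_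
  · exact ⟨0, 0, Fin.elim0, Fin.elim0, by simp; rfl, by simp⟩
  · intro x y
    exact ⟨‖x‖ * ‖y‖, 1, fun _ => x, fun _ => y, (Fin.sum_univ_one fun _ => tmul x y).symm, by simp⟩
  · rintro u v ⟨r, hr⟩ ⟨s, hs⟩
    exact ⟨r + s, costs_add hr hs⟩

theorem norm_le_of_mem {u : ProjAlg E F} {r : ℝ} (hr : r ∈ costs u) : ‖u‖ ≤ r :=
  csInf_le (costs_bddBelow u) hr

/-- The projective norm, bundled as a seminorm. -/
noncomputable def projSeminorm : Seminorm ℂ (ProjAlg E F) :=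
  Seminorm.ofSMulLE (fun u => ‖u‖)
    (le_antisymm (norm_le_of_mem ⟨0, Fin.elim0, Fin.elim0, by simp, by simp⟩)
      (le_csInf (costs_nonempty _) fun _ hr => costs_nonneg hr))
    (fun u v => by
      refine le_of_forall_pos_le_add fun ε hε => ?_
      obtain ⟨r, hr, hr'⟩ := exists_lt_of_csInf_lt (costs_nonempty u)
        (show sInf (costs u) < ‖u‖ + ε / 2 from lt_add_of_pos_right _ (half_pos hε))
      obtain ⟨s, hs, hs'⟩ := exists_lt_of_csInf_lt (costs_nonempty v)
        (show sInf (costs v) < ‖v‖ + ε / 2 from lt_add_of_pos_right _ (half_pos hε))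
      have := norm_le_of_mem (costs_add hr hs)
      linarith)
    (fun a u => by
      rw [norm_def u, ← smul_eq_mul, ← Real.sInf_smul_of_nonneg (norm_nonneg a)]
      refine le_csInf (costs_nonempty u).smul_set ?_
      rintro _ ⟨r, hr, rfl⟩
      exact norm_le_of_mem (costs_smul a hr))

noncomputable instance : SeminormedAddCommGroup (ProjAlg E F) :=
  fast_instance% projSeminorm.toAddGroupSeminorm.toSeminormedAddCommGroup

noncomputable instance : NormedSpace ℂ (ProjAlg E F) :=
  ⟨fun a u => (map_smul_eq_mul projSeminorm a u).le⟩

end ProjAlg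

/-- The projective tensor product `E ⊗̂ F`: the completion of `E ⊗ F` for the projective norm. -/
abbrev ProjTensor (E F : Type*) [NormedAddCommGroup E] [NormedSpace ℂ E]
    [NormedAddCommGroup F] [NormedSpace ℂ F] : Type _ :=
  UniformSpace.Completion (ProjAlg E F)

/-! ### Vector-valued `L¹` and Hardy space on the circle -/

namespace Hardy

instance fact_two_pi_pos : Fact (0 < 2 * π) := ⟨Real.two_pi_pos⟩

/-- The unit circle, parametrized by the angle. -/
abbrev Torus : Type := AddCircle (2 * π)

/-- The space `L¹(𝕋; X)` of (classes of) strongly measurable functions, for the normalized Haar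
measure of the circle. -/
abbrev L1 (X : Type*) [NormedAddCommGroup X] : Type _ :=
  Lp X 1 (AddCircle.haarAddCircle : Measure Torus)

variable (X : Type*) [NormedAddCommGroup X] [NormedSpace ℂ X]

/-- The bilinear map sending a scalar function `h` and a vector `x` to `θ ↦ h θ • x`. -/
noncomputable def vec : L1 ℂ →ₗ[ℂ] X →ₗ[ℂ] L1 X :=
  LinearMap.mk₂ ℂ (fun h x => (ContinuousLinearMap.toSpanSingleton ℂ x).compLp h)
    (fun h h' x => map_add (ContinuousLinearMap.compLpₗ 1 AddCircle.haarAddCircle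
      (ContinuousLinearMap.toSpanSingleton ℂ x)) h h')
    (fun a h x => map_smul (ContinuousLinearMap.compLpₗ 1 AddCircle.haarAddCircle
      (ContinuousLinearMap.toSpanSingleton ℂ x)) a h)
    (fun h x y => by
      rw [ContinuousLinearMap.toSpanSingleton_add, ContinuousLinearMap.add_compLp])
    (fun a h x => by
      rw [ContinuousLinearMap.toSpanSingleton_smul, ContinuousLinearMap.smul_compLp])

theorem coeFn_vec (h : L1 ℂ) (x : X) :
    vec X h x =ᵐ[AddCircle.haarAddCircle] fun θ => h θ • x :=
  (ContinuousLinearMap.toSpanSingleton ℂ x).coeFn_compLp h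

theorem norm_vec_le (h : L1 ℂ) (x : X) : ‖vec X h x‖ ≤ ‖h‖ * ‖x‖ := by
  have := (ContinuousLinearMap.toSpanSingleton ℂ x).norm_compLp_le h
  rw [ContinuousLinearMap.norm_toSpanSingleton] at this
  exact this.trans_eq (mul_comm ‖x‖ ‖h‖)

/-- The `X`-valued analytic polynomials `∑ e^{ikθ} x_k`, `k ≥ 0`: the linear span of the
monomials `e^{ikθ} x`. -/
noncomputable def analyticPolynomials : Submodule ℂ (L1 X) :=
  Submodule.span ℂ {f | ∃ (k : ℕ) (x : X), f = vec X (fourierLp 1 (k : ℤ)) x}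

/-- The Hardy space `H̃¹(X)`: the closure in `L¹(𝕋; X)` of the `X`-valued analytic polynomials.
The scalar space `H¹` is `H1 ℂ`. -/
noncomputable abbrev H1 : Submodule ℂ (L1 X) := (analyticPolynomials X).topologicalClosure

theorem vec_mem_H1 (h : H1 ℂ) (x : X) : vec X h x ∈ H1 X := by
  have hle : analyticPolynomials ℂ ≤ (analyticPolynomials X).comap ((vec X).flip x) := by
    refine Submodule.span_le.2 ?_
    rintro _ ⟨k, c, rfl⟩
    refine Submodule.subset_span ⟨k, c • x, ?_⟩
    apply Lp.ext
    filter_upwards [coeFn_vec X (vec ℂ (fourierLp 1 (k : ℤ)) c) x,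
      coeFn_vec X (fourierLp 1 (k : ℤ)) (c • x), coeFn_vec ℂ (fourierLp 1 (k : ℤ)) c]
      with θ h1 h2 h3
    rw [LinearMap.flip_apply, h1, h2, h3, smul_smul, smul_eq_mul]
  have hc : Continuous fun f : L1 ℂ => vec X f x :=
    ((ContinuousLinearMap.toSpanSingleton ℂ x).compLpL 1
      (AddCircle.haarAddCircle : Measure Torus)).continuous
  exact map_mem_closure (f := fun f : L1 ℂ => vec X f x) hc h.2 fun f hf => hle hf

/-- The canonical linear map `H¹ ⊗ X → H̃¹(X)`, `h ⊗ x ↦ (θ ↦ h θ • x)`, on the algebraic tensor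
product. -/
noncomputable def algInclusion : ProjAlg (H1 ℂ) X →ₗ[ℂ] H1 X :=
  TensorProduct.lift (LinearMap.mk₂ ℂ
    (fun (h : H1 ℂ) (x : X) => (⟨vec X h x, vec_mem_H1 X h x⟩ : H1 X))
    (fun h h' x => Subtype.ext (by simp))
    (fun a h x => Subtype.ext (by simp))
    (fun h x y => Subtype.ext (by simp))
    (fun a h x => Subtype.ext (by simp)))

theorem algInclusion_tmul (h : H1 ℂ) (x : X) :
    (algInclusion X (ProjAlg.tmul h x) : L1 X) = vec X h x :=
  rfl

theorem norm_algInclusion_le (u : ProjAlg (H1 ℂ) X) : ‖algInclusion X u‖ ≤ 1 * ‖u‖ := by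
  rw [one_mul, ProjAlg.norm_def]
  refine le_csInf (ProjAlg.costs_nonempty u) ?_
  rintro _ ⟨n, h, x, rfl, rfl⟩
  rw [map_sum]
  refine norm_sum_le_of_le _ fun k _ => ?_
  exact norm_vec_le X (h k) (x k)

variable [CompleteSpace X]

/-- The canonical inclusion `H¹ ⊗̂ X → H̃¹(X)`: the continuous extension to the completed projective
tensor product of `h ⊗ x ↦ (θ ↦ h θ • x)`. -/
noncomputable def inclusion : ProjTensor (H1 ℂ) X →L[ℂ] H1 X :=
  ((algInclusion X).mkContinuous 1 (norm_algInclusion_le X)).extend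
    (UniformSpace.Completion.toComplL (𝕜 := ℂ) (E := ProjAlg (H1 ℂ) X))

theorem inclusion_coe (u : ProjAlg (H1 ℂ) X) :
    inclusion X (u : ProjTensor (H1 ℂ) X) = algInclusion X u :=
  ((algInclusion X).mkContinuous 1 (norm_algInclusion_le X)).extend_eq
    (e := UniformSpace.Completion.toComplL (𝕜 := ℂ) (E := ProjAlg (H1 ℂ) X))
    UniformSpace.Completion.denseRange_coe
    (UniformSpace.Completion.isUniformInducing_coe _) u

/-- `X` is `H¹`-projective if the canonical inclusion `H¹ ⊗̂ X → H̃¹(X)` is surjective. -/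
def IsH1Projective : Prop := Function.Surjective (inclusion X)

/-- The `H¹`-projectivity constant of `X`: the smallest `c ≥ 0` such that
`‖F‖ ≤ c * ‖F‖_{H̃¹(X)}` for all `F ∈ H¹ ⊗̂ X`, with the value `∞` if there is no such `c`. -/
noncomputable def eta : ℝ≥0∞ :=
  ⨅ (c : ℝ≥0) (_ : ∀ F : ProjTensor (H1 ℂ) X, ‖F‖ ≤ c * ‖inclusion X F‖), (c : ℝ≥0∞)

/-- A finite `eta X` is itself an admissible constant, so that the infimum is a minimum. -/
theorem norm_le_eta (h : eta X ≠ ∞) (F : ProjTensor (H1 ℂ) X) :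
    ‖F‖ ≤ (eta X).toReal * ‖inclusion X F‖ := by
  refine le_of_forall_pos_le_add fun ε hε => ?_
  have hd : 0 < ‖inclusion X F‖ + 1 := by positivity
  have hlt : eta X < eta X + ENNReal.ofReal (ε / (‖inclusion X F‖ + 1)) :=
    ENNReal.lt_add_right h (by simpa using div_pos hε hd)
  conv_lhs at hlt => unfold eta
  simp only [iInf_lt_iff] at hlt
  obtain ⟨c, hc, hlt⟩ := hlt
  have h1 := ENNReal.toReal_mono (ENNReal.add_ne_top.2 ⟨h, ENNReal.ofReal_ne_top⟩) hlt.le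
  rw [ENNReal.toReal_add h ENNReal.ofReal_ne_top, ENNReal.toReal_ofReal (by positivity)] at h1
  have h2 : ε / (‖inclusion X F‖ + 1) * ‖inclusion X F‖ ≤ ε := by
    rw [div_mul_eq_mul_div, div_le_iff₀ hd]
    nlinarith
  calc ‖F‖ ≤ c * ‖inclusion X F‖ := hc F
    _ ≤ ((eta X).toReal + ε / (‖inclusion X F‖ + 1)) * ‖inclusion X F‖ := by
        gcongr
        exact h1
    _ ≤ _ := by linarith

end Hardy

/-! Both constants are decided on algebraic tensors, where `c` is admissible iff `‖u‖ ≤ c *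
‖algInclusion _ u‖`; it remains to compare these bounds for `X` and `X**`.

From `X**` to `X`: an operator `S : H¹ → X*`, seen as a bilinear form on `H¹ × X`, extends to `H¹ ×
X**` by `(h, ξ) ↦ ξ (S h)` without increase of norm. Hence the projective norm of `H¹ ⊗ X` may be
computed in `H¹ ⊗ X**` (`norm_le_mapRight_bidual`), and the `L¹` norms agree because `X → X**` is
isometric.

From `X` to `X**`: given `S : H¹ → X*`, the assumed bound and Hahn–Banach yield a functional `Φ` on
`L¹(X)` that induces `S`. Viewed as an operator `L¹ → X* → X***`, it gives a functional on `L¹(X**)`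
with the same bound, so the pairing of `S` with `u` is at most `c * ‖algInclusion _ u‖ * ‖S‖`
(`norm_pairing_le_of_norm_le`). Such pairings do determine the projective norm of `V ⊗ X**` when `V`
is finite-dimensional (`norm_le_of_forall_pairing`, a form of local reflexivity). The Fejér means,
contractions of finite rank on `H¹` that converge strongly to the identity, reduce `H¹` to that
case.

Finally, projectivity is equivalent to `eta X ≠ ∞`: the canonical map is injective by the same
approximation property and has dense range, so the open mapping theorem applies
(`isH1Projective_iff`). -/

/-! ### Hahn–Banach factorization and functionals on finite sup-norm products -/

/-- A linear functional dominated by `C * ‖J ·‖` factors through `J` by a functional of norm at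
most `C`. -/
theorem exists_dual_comp_eq {A B : Type*} [AddCommGroup A] [Module ℂ A] [NormedAddCommGroup B]
    [NormedSpace ℂ B] (J : A →ₗ[ℂ] B) (l : A →ₗ[ℂ] ℂ) {C : ℝ} (hC : 0 ≤ C)
    (h : ∀ a, ‖l a‖ ≤ C * ‖J a‖) :
    ∃ Φ : StrongDual ℂ B, ‖Φ‖ ≤ C ∧ ∀ a, Φ (J a) = l a := by
  have hker : LinearMap.ker J ≤ LinearMap.ker l := fun a ha => by
    have := h a
    rw [LinearMap.mem_ker.1 ha, norm_zero, mul_zero] at this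
    exact norm_le_zero_iff.1 this
  let f : LinearMap.range J →ₗ[ℂ] ℂ :=
    (LinearMap.ker J).liftQ l hker ∘ₗ J.quotKerEquivRange.symm.toLinearMap
  have hf : ∀ a, f ⟨J a, LinearMap.mem_range_self J a⟩ = l a := fun a => by
    have : J.quotKerEquivRange.symm ⟨J a, LinearMap.mem_range_self J a⟩ =
        (LinearMap.ker J).mkQ a := J.quotKerEquivRange_symm_apply_image a _
    simp [f, this]
  have hb : ∀ b, ‖f b‖ ≤ C * ‖b‖ := by
    rintro ⟨_, a, rfl⟩
    rw [hf]
    exact h a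
  obtain ⟨Φ, h1, h2⟩ := exists_extension_norm_eq _ (f.mkContinuous C hb)
  refine ⟨Φ, h2 ▸ f.mkContinuous_norm_le hC hb, fun a => ?_⟩
  rw [← hf a]
  exact h1 ⟨J a, LinearMap.mem_range_self J a⟩

/-- On a finite product with the sup norm, the norms of the components of a functional sum to at
most its norm. -/
theorem sum_norm_comp_single_le {ι Y : Type*} [Fintype ι] [DecidableEq ι] [NormedAddCommGroup Y]
    [NormedSpace ℂ Y] (G : StrongDual ℂ (ι → Y)) :
    ∑ i, ‖G.comp (ContinuousLinearMap.single ℂ (fun _ : ι => Y) i)‖ ≤ ‖G‖ := by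
  refine le_of_forall_pos_le_add fun ε hε => ?_
  have hd : 0 < ε / (Fintype.card ι + 1) := by positivity
  have key : ∀ i, ∃ y : Y, ‖y‖ ≤ 1 ∧ ∃ r : ℝ, G (Pi.single i y) = (r : ℂ) ∧
      ‖G.comp (ContinuousLinearMap.single ℂ (fun _ : ι => Y) i)‖ - ε / (Fintype.card ι + 1) ≤ r := by
    intro i
    obtain ⟨y, hy, hy'⟩ := ContinuousLinearMap.exists_lt_apply_of_lt_opNorm
      (G.comp (ContinuousLinearMap.single ℂ (fun _ : ι => Y) i)) (sub_lt_self _ hd)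
    -- A unimodular rotation makes each value real and nonnegative, so that the near-maximal values
    -- add up without cancellation.
    obtain ⟨c, hc, hc'⟩ := RCLike.exists_norm_eq_mul_self (G (Pi.single i y))
    refine ⟨c • y, by rw [norm_smul, hc, one_mul]; exact hy.le, ‖G (Pi.single i y)‖, ?_, ?_⟩
    · rw [Pi.single_smul, map_smul, smul_eq_mul]
      exact hc'.symm
    · exact hy'.le
  choose y hy r hr hr' using key
  have h1 : G y = ((∑ i, r i : ℝ) : ℂ) := by
    rw [← Finset.univ_sum_single y, map_sum]
    simp [hr]
  have h2 : ∑ i, r i ≤ ‖G‖ := by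
    calc ∑ i, r i ≤ ‖((∑ i, r i : ℝ) : ℂ)‖ := by
          rw [Complex.norm_real]; exact le_abs_self _
      _ = ‖G y‖ := by rw [h1]
      _ ≤ ‖G‖ * ‖y‖ := G.le_opNorm y
      _ ≤ ‖G‖ * 1 := by
          gcongr
          exact (pi_norm_le_iff_of_nonneg zero_le_one).2 hy
      _ = ‖G‖ := mul_one _
  have h3 : ∑ i, ‖G.comp (ContinuousLinearMap.single ℂ (fun _ : ι => Y) i)‖ ≤
      ∑ i, (r i + ε / (Fintype.card ι + 1)) :=
    Finset.sum_le_sum fun i _ => by linarith [hr' i]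
  rw [Finset.sum_add_distrib, Finset.sum_const, Finset.card_univ, nsmul_eq_mul] at h3
  have h4 : (Fintype.card ι : ℝ) * (ε / (Fintype.card ι + 1)) ≤ ε := by
    rw [mul_div_assoc', div_le_iff₀ (by positivity)]
    nlinarith
  linarith

/-! ### Projective tensor norms: functoriality, slices, and the pairing of `E ⊗ F**` with operators
`E → F*` -/

namespace ProjAlg

variable {E E' F G : Type*} [NormedAddCommGroup E] [NormedSpace ℂ E]
  [NormedAddCommGroup E'] [NormedSpace ℂ E'] [NormedAddCommGroup F] [NormedSpace ℂ F]
  [SeminormedAddCommGroup G] [NormedSpace ℂ G]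

/-- The elementary tensor as a bilinear map. -/
noncomputable def mk : E →ₗ[ℂ] F →ₗ[ℂ] ProjAlg E F := TensorProduct.mk ℂ E F

theorem mk_apply (x : E) (y : F) : mk x y = tmul x y := rfl

/-- The linear map on `E ⊗ F` defined by a bilinear map. -/
noncomputable def lift (B : E →ₗ[ℂ] F →ₗ[ℂ] G) : ProjAlg E F →ₗ[ℂ] G := TensorProduct.lift B

theorem lift_tmul (B : E →ₗ[ℂ] F →ₗ[ℂ] G) (x : E) (y : F) : lift B (tmul x y) = B x y :=
  TensorProduct.lift.tmul x y

theorem hom_ext {M : Type*} [AddCommGroup M] [Module ℂ M] {f g : ProjAlg E F →ₗ[ℂ] M}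
    (h : ∀ x y, f (tmul x y) = g (tmul x y)) : f = g :=
  TensorProduct.ext' h

theorem induction_on {p : ProjAlg E F → Prop} (u : ProjAlg E F) (zero : p 0)
    (tmul : ∀ x y, p (tmul x y)) (add : ∀ u v, p u → p v → p (u + v)) : p u :=
  TensorProduct.induction_on (motive := p) u zero tmul add

theorem norm_lift_le (B : E →ₗ[ℂ] F →ₗ[ℂ] G) {C : ℝ} (hC : 0 ≤ C)
    (hB : ∀ x y, ‖B x y‖ ≤ C * (‖x‖ * ‖y‖)) (u : ProjAlg E F) : ‖lift B u‖ ≤ C * ‖u‖ := by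
  rw [norm_def u, ← smul_eq_mul, ← Real.sInf_smul_of_nonneg hC]
  refine le_csInf (costs_nonempty u).smul_set ?_
  rintro _ ⟨_, ⟨n, x, y, rfl, rfl⟩, rfl⟩
  simp only [map_sum, lift_tmul, smul_eq_mul, Finset.mul_sum]
  exact norm_sum_le_of_le _ fun k _ => hB _ _

theorem norm_tmul_le (x : E) (y : F) : ‖tmul x y‖ ≤ ‖x‖ * ‖y‖ :=
  norm_le_of_mem ⟨1, fun _ => x, fun _ => y, (Fin.sum_univ_one fun _ => tmul x y).symm, by simp⟩

/-- The map `A ⊗ id`. -/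
noncomputable def mapLeft (A : E →L[ℂ] E') : ProjAlg E F →ₗ[ℂ] ProjAlg E' F :=
  lift (mk ∘ₗ A.toLinearMap)

theorem mapLeft_tmul (A : E →L[ℂ] E') (x : E) (y : F) :
    mapLeft A (tmul x y) = tmul (A x) y := lift_tmul _ _ _

theorem norm_mapLeft_le (A : E →L[ℂ] E') (u : ProjAlg E F) : ‖mapLeft A u‖ ≤ ‖A‖ * ‖u‖ := by
  refine norm_lift_le _ (norm_nonneg A) (fun x y => ?_) u
  refine (norm_tmul_le (A x) y).trans ?_
  rw [← mul_assoc]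
  gcongr
  exact A.le_opNorm x

/-- If `A n → id` strongly, then `A n ⊗ id → id` on tensors. -/
theorem tendsto_mapLeft {A : ℕ → E →L[ℂ] E}
    (hA : ∀ x, Filter.Tendsto (fun n => A n x) Filter.atTop (nhds x)) (u : ProjAlg E F) :
    Filter.Tendsto (fun n => mapLeft (A n) u) Filter.atTop (nhds u) := by
  refine induction_on (p := fun u : ProjAlg E F =>
    Filter.Tendsto (fun n => mapLeft (A n) u) Filter.atTop (nhds u)) u ?_ ?_ ?_
  · simp only [map_zero]
    exact tendsto_const_nhds
  · intro x y
    simp only [mapLeft_tmul]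
    rw [tendsto_iff_norm_sub_tendsto_zero]
    have h1 : Filter.Tendsto (fun n => ‖A n x - x‖ * ‖y‖) Filter.atTop (nhds (0 * ‖y‖)) :=
      (tendsto_iff_norm_sub_tendsto_zero.1 (hA x)).mul_const _
    rw [zero_mul] at h1
    refine squeeze_zero (fun _ => norm_nonneg _) (fun n => ?_) h1
    have : tmul (A n x) y - tmul x y = tmul (A n x - x) y := by
      simp only [← mk_apply, map_sub, LinearMap.sub_apply]
    rw [this]
    exact norm_tmul_le _ _
  · intro u v hu hv
    simpa only [map_add] using hu.add hv

/-- The map `id ⊗ B`. -/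
noncomputable def mapRight (B : F →L[ℂ] E') : ProjAlg E F →ₗ[ℂ] ProjAlg E E' :=
  lift (mk.compl₂ B.toLinearMap)

theorem mapRight_tmul (B : F →L[ℂ] E') (x : E) (y : F) :
    mapRight B (tmul x y) = tmul x (B y) := lift_tmul _ _ _

/-- The slice map `φ ⊗ id : E ⊗ F → F`. -/
noncomputable def slice (φ : StrongDual ℂ E) : ProjAlg E F →ₗ[ℂ] F :=
  lift ((LinearMap.lsmul ℂ F).comp φ.toLinearMap)

theorem slice_tmul (φ : StrongDual ℂ E) (x : E) (y : F) : slice φ (tmul x y) = φ x • y :=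
  lift_tmul _ _ _

/-- An operator `A = ∑ φ i ⊗ v i` of finite rank acts on tensors through finitely many slices. -/
theorem mapLeft_eq_sum_slice {ι : Type*} [Fintype ι] (A : E →L[ℂ] E') (φ : ι → StrongDual ℂ E)
    (v : ι → E') (hA : ∀ x, A x = ∑ i, φ i x • v i) (u : ProjAlg E F) :
    mapLeft A u = ∑ i, tmul (v i) (slice (φ i) u) := by
  have : mapLeft A = ∑ i, (mk (F := F) (v i)) ∘ₗ slice (φ i) := by
    refine hom_ext fun x y => ?_
    simp only [mapLeft_tmul, hA, LinearMap.sum_apply, LinearMap.comp_apply, slice_tmul, map_smul]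
    rw [← mk_apply, map_sum, LinearMap.sum_apply]
    simp only [map_smul, LinearMap.smul_apply]
  rw [this]
  simp [mk_apply]

/-- The pairing of `E ⊗ F**` with operators `E → F*`, namely `h ⊗ ξ ↦ ξ (S h)`. -/
noncomputable def pairing (S : E →L[ℂ] StrongDual ℂ F) :
    ProjAlg E (StrongDual ℂ (StrongDual ℂ F)) →ₗ[ℂ] ℂ :=
  lift (LinearMap.mk₂ ℂ (fun h ξ => ξ (S h)) (by simp) (by simp) (by simp) (by simp))

theorem pairing_tmul (S : E →L[ℂ] StrongDual ℂ F) (h : E) (ξ : StrongDual ℂ (StrongDual ℂ F)) :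
    pairing S (tmul h ξ) = ξ (S h) := lift_tmul _ _ _

theorem norm_pairing_le (S : E →L[ℂ] StrongDual ℂ F)
    (u : ProjAlg E (StrongDual ℂ (StrongDual ℂ F))) : ‖pairing S u‖ ≤ ‖S‖ * ‖u‖ := by
  refine norm_lift_le _ (norm_nonneg S) (fun x ξ => ?_) u
  calc ‖ξ (S x)‖ ≤ ‖ξ‖ * ‖S x‖ := ξ.le_opNorm _
    _ ≤ ‖ξ‖ * (‖S‖ * ‖x‖) := by gcongr; exact S.le_opNorm x
    _ = _ := by ring

theorem pairing_mapLeft (S : E' →L[ℂ] StrongDual ℂ F) (A : E →L[ℂ] E')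
    (u : ProjAlg E (StrongDual ℂ (StrongDual ℂ F))) :
    pairing S (mapLeft A u) = pairing (S.comp A) u := by
  have : pairing S ∘ₗ mapLeft A = pairing (S.comp A) :=
    hom_ext fun x y => by simp [mapLeft_tmul, pairing_tmul]
  exact LinearMap.congr_fun this u

/-- A finite-dimensional space `V` has operators `V → F*` separating the points of `V ⊗ F**`. -/
theorem eq_zero_of_pairing_eq_zero [FiniteDimensional ℂ E]
    (w : ProjAlg E (StrongDual ℂ (StrongDual ℂ F)))
    (h : ∀ S : E →L[ℂ] StrongDual ℂ F, pairing S w = 0) : w = 0 := by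
  let b := Module.finBasis ℂ E
  have h1 := mapLeft_eq_sum_slice (ContinuousLinearMap.id ℂ E)
    (fun i => LinearMap.toContinuousLinearMap (b.coord i)) b
    (fun x => by simp [b.sum_repr x]) w
  have h2 : mapLeft (ContinuousLinearMap.id ℂ E) w = w := by
    have : mapLeft (F := StrongDual ℂ (StrongDual ℂ F)) (ContinuousLinearMap.id ℂ E) =
      LinearMap.id := hom_ext fun x y => by simp [mapLeft_tmul]
    rw [this]; rfl
  rw [← h2, h1]
  refine Finset.sum_eq_zero fun i _ => ?_
  have h3 : slice (LinearMap.toContinuousLinearMap (b.coord i)) w = 0 := by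
    -- The elements of `F**` are separated by `f ∈ F*`, and evaluating the slice at `f` is pairing
    -- with the rank-one operator `b.coord i ⊗ f`.
    ext f
    have h4 : (ContinuousLinearMap.apply ℂ ℂ f).toLinearMap ∘ₗ
        slice (LinearMap.toContinuousLinearMap (b.coord i)) =
        pairing ((LinearMap.toContinuousLinearMap (b.coord i)).smulRight f) :=
      hom_ext fun x y => by simp [slice_tmul, pairing_tmul]
    exact (LinearMap.congr_fun h4 w).trans (h _)
  rw [h3, ← mk_apply, map_zero]

/-- For finite-dimensional `V`, the projective norm of `V ⊗ F**` is determined by the operators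
`V → F*`. -/
theorem norm_le_of_forall_pairing [FiniteDimensional ℂ E]
    (w : ProjAlg E (StrongDual ℂ (StrongDual ℂ F))) {C : ℝ} (hC : 0 ≤ C)
    (h : ∀ S : E →L[ℂ] StrongDual ℂ F, ‖pairing S w‖ ≤ C * ‖S‖) : ‖w‖ ≤ C := by
  classical
  suffices H : ∀ ε : ℝ, 0 < ε → ε < 1 → (1 - ε) * ‖w‖ ≤ C by
    have h1 : Filter.Tendsto (fun ε : ℝ => (1 - ε) * ‖w‖) (nhdsWithin 0 (Set.Ioi 0))
        (nhds ((1 - 0) * ‖w‖)) :=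
      (Continuous.tendsto (by fun_prop) 0).mono_left nhdsWithin_le_nhds
    rw [sub_zero, one_mul] at h1
    refine le_of_tendsto h1 ?_
    filter_upwards [Ioo_mem_nhdsGT (zero_lt_one (α := ℝ))] with ε hε
    exact H ε hε.1 hε.2
  intro ε hε hε1
  have : ProperSpace E := FiniteDimensional.proper ℂ E
  -- Restriction to a finite `ε`-net `t` of the unit ball embeds the operators `E → F*` into the
  -- sup-norm product of copies of `F*` over `t`, distorting norms by at most `1 - ε`.
  obtain ⟨t, hts, htf, htc⟩ := (isCompact_closedBall (0 : E) 1).finite_cover_balls hε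
  have := htf.fintype
  let J : (E →L[ℂ] StrongDual ℂ F) →ₗ[ℂ] (t → StrongDual ℂ F) :=
    LinearMap.pi fun i => (ContinuousLinearMap.apply ℂ (StrongDual ℂ F) (i : E)).toLinearMap
  have hJ : ∀ S i, J S i = S i := fun S i => rfl
  let l : (E →L[ℂ] StrongDual ℂ F) →ₗ[ℂ] ℂ :=
    { toFun := fun S => pairing S w
      map_add' := fun S S' => by
        have : pairing (S + S') = pairing S + pairing S' :=
          hom_ext fun x y => by simp [pairing_tmul]
        rw [this]; rfl
      map_smul' := fun a S => by
        have : pairing (a • S) = a • pairing S :=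
          hom_ext fun x y => by simp [pairing_tmul]
        rw [this]; rfl }
  have hS : ∀ S : E →L[ℂ] StrongDual ℂ F, (1 - ε) * ‖S‖ ≤ ‖J S‖ := by
    intro S
    suffices ‖S‖ ≤ ‖J S‖ + ε * ‖S‖ by linarith
    refine ContinuousLinearMap.opNorm_le_of_unit_norm (by positivity) fun v hv => ?_
    obtain ⟨i, hi, hvi⟩ := Set.mem_iUnion₂.1 (htc (by simp [hv] : v ∈ Metric.closedBall (0 : E) 1))
    rw [Metric.mem_ball, dist_eq_norm] at hvi
    calc ‖S v‖ = ‖S i + S (v - i)‖ := by rw [map_sub]; abel_nf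
      _ ≤ ‖S i‖ + ‖S (v - i)‖ := norm_add_le _ _
      _ ≤ ‖J S‖ + ‖S‖ * ε := add_le_add (norm_le_pi_norm (J S) ⟨i, hi⟩)
          ((S.le_opNorm _).trans (by gcongr))
      _ = _ := by ring
  have h1ε : 0 < 1 - ε := by linarith
  obtain ⟨Φ, hΦ, hΦ'⟩ := exists_dual_comp_eq J l (C := C / (1 - ε)) (by positivity) fun S =>
    (h S).trans (by
      rw [div_mul_eq_mul_div, le_div_iff₀ h1ε, mul_assoc, mul_comm ‖S‖]
      gcongr
      exact hS S)
  -- The components of `Φ` lie in `F**`, so `Φ` itself is a representation of `w` over the net,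
  -- whose cost is at most `‖Φ‖`.
  have hw : w = ∑ i : t, tmul (i : E)
      (Φ.comp (ContinuousLinearMap.single ℂ (fun _ : t => StrongDual ℂ F) i)) := by
    rw [← sub_eq_zero]
    refine eq_zero_of_pairing_eq_zero _ fun S => ?_
    rw [map_sub, sub_eq_zero, map_sum]
    refine (hΦ' S).symm.trans ?_
    rw [← Finset.univ_sum_single (J S), map_sum]
    exact Finset.sum_congr rfl fun i _ => by rw [pairing_tmul]; rfl
  rw [mul_comm, ← le_div_iff₀ h1ε]
  calc ‖w‖ ≤ ∑ i : t, ‖tmul (i : E)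
        (Φ.comp (ContinuousLinearMap.single ℂ (fun _ : t => StrongDual ℂ F) i))‖ := by
        conv_lhs => rw [hw]
        exact norm_sum_le _ _
    _ ≤ ∑ i : t, ‖Φ.comp (ContinuousLinearMap.single ℂ (fun _ : t => StrongDual ℂ F) i)‖ :=
        Finset.sum_le_sum fun i _ => (norm_tmul_le _ _).trans
          (mul_le_of_le_one_left (by positivity) (mem_closedBall_zero_iff.1 (hts i.2)))
    _ ≤ ‖Φ‖ := sum_norm_comp_single_le Φ
    _ ≤ _ := hΦ

/-- The projective norm of `(R ⊗ id) u`, for a contraction `R` of finite rank, is controlled by the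
pairing of `u` with operators into `F*`. -/
theorem norm_mapLeft_le_of_forall_pairing (R : E →L[ℂ] E') (hR : ‖R‖ ≤ 1)
    (hRf : FiniteDimensional ℂ (LinearMap.range R.toLinearMap))
    (u : ProjAlg E (StrongDual ℂ (StrongDual ℂ F))) {C : ℝ} (hC : 0 ≤ C)
    (h : ∀ S : E →L[ℂ] StrongDual ℂ F, ‖pairing S u‖ ≤ C * ‖S‖) : ‖mapLeft R u‖ ≤ C := by
  let V : Submodule ℂ E' := LinearMap.range R.toLinearMap
  -- With the range `V` as codomain the finite-dimensional case applies: each `S : V → F*` pulls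
  -- back to `S ∘ R'` on `E` with norm at most `‖S‖`.
  let R' : E →L[ℂ] V := R.codRestrict V fun x => LinearMap.mem_range_self _ x
  have hR' : ‖R'‖ ≤ 1 := ContinuousLinearMap.opNorm_le_bound _ zero_le_one fun x =>
    R.le_of_opNorm_le hR x
  have h1 : ‖mapLeft R' u‖ ≤ C :=
    norm_le_of_forall_pairing _ hC fun S => by
      rw [pairing_mapLeft]
      refine (h _).trans ?_
      gcongr
      exact (S.opNorm_comp_le R').trans (mul_le_of_le_one_right (norm_nonneg _) hR')
  have h2 : mapLeft R u = mapLeft V.subtypeL (mapLeft R' u) := by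
    have : mapLeft (F := StrongDual ℂ (StrongDual ℂ F)) R = mapLeft V.subtypeL ∘ₗ mapLeft R' :=
      hom_ext fun x y => by
        rw [LinearMap.comp_apply]
        simp only [mapLeft_tmul]
        rfl
    exact LinearMap.congr_fun this u
  rw [h2]
  exact (norm_mapLeft_le _ _).trans
    ((mul_le_of_le_one_left (norm_nonneg (mapLeft R' u)) V.norm_subtypeL_le).trans h1)

/-- The inclusion `E ⊗ F → E ⊗ F**` does not decrease the projective norm. -/
theorem norm_le_mapRight_bidual (u : ProjAlg E F) :
    ‖u‖ ≤ ‖mapRight (E' := StrongDual ℂ (StrongDual ℂ F))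
      (NormedSpace.inclusionInDoubleDual ℂ F) u‖ := by
  obtain ⟨g, hg, hgu⟩ := exists_dual_vector'' ℂ u
  -- The norming functional `g` is a bilinear form on `E × F`, hence an operator `E → F*`; pairing
  -- with it extends `g` to `E ⊗ F**`.
  let S : E →L[ℂ] StrongDual ℂ F :=
    (mk.compr₂ g.toLinearMap).mkContinuous₂ 1 fun x y => by
      rw [mul_assoc]
      exact (g.le_of_opNorm_le hg _).trans (by gcongr; exact norm_tmul_le x y)
  have hS : ‖S‖ ≤ 1 := LinearMap.mkContinuous₂_norm_le _ zero_le_one _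
  have h1 : pairing S ∘ₗ mapRight (E' := StrongDual ℂ (StrongDual ℂ F))
      (NormedSpace.inclusionInDoubleDual ℂ F) = g.toLinearMap := hom_ext fun x y => by
    rw [LinearMap.comp_apply, mapRight_tmul, pairing_tmul]
    rfl
  calc ‖u‖ = ‖g u‖ := by rw [hgu]; simp
    _ = ‖pairing S (mapRight (E' := StrongDual ℂ (StrongDual ℂ F))
          (NormedSpace.inclusionInDoubleDual ℂ F) u)‖ := by
        rw [← LinearMap.comp_apply, h1]; rfl
    _ ≤ 1 * _ := (norm_pairing_le _ _).trans (by gcongr)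
    _ = _ := one_mul _

end ProjAlg

/-! ### Fejér means and the metric approximation property of `H¹` -/

namespace Hardy

theorem vec_eq_smul (h : L1 ℂ) (c : ℂ) : vec ℂ h c = c • h := by
  apply Lp.ext
  filter_upwards [coeFn_vec ℂ h c, Lp.coeFn_smul c h] with θ h1 h2
  rw [h1, h2, Pi.smul_apply, smul_eq_mul, smul_eq_mul, mul_comm]

/-- The `n`-th Fourier coefficient as a linear functional on `L¹`. -/
noncomputable def coeffₗ (n : ℤ) : L1 ℂ →ₗ[ℂ] ℂ where
  toFun h := fourierCoeff h n
  map_add' f g := by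
    rw [fourierCoeff_congr_ae (Lp.coeFn_add f g),
      fourierCoeff.add (L1.integrable_coeFn f) (L1.integrable_coeFn g), Pi.add_apply]
  map_smul' c f := by
    rw [fourierCoeff_congr_ae (Lp.coeFn_smul c f), fourierCoeff.const_smul, RingHom.id_apply]

theorem coeffₗ_apply (n : ℤ) (h : L1 ℂ) : coeffₗ n h = fourierCoeff h n := rfl

/-- The Fejér kernel of order `n`, namely `|∑_{j ≤ n} e^{ijθ}|² / (n + 1)`. -/
noncomputable def fejerKernel (n : ℕ) (θ : Torus) : ℝ :=
  ‖∑ j ∈ Finset.range (n + 1), fourier (j : ℤ) θ‖ ^ 2 / (n + 1)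

/-- The Fejér mean of order `n`. -/
noncomputable def fejerₗ (n : ℕ) : L1 ℂ →ₗ[ℂ] L1 ℂ :=
  ((n : ℂ) + 1)⁻¹ • ∑ j ∈ Finset.range (n + 1), ∑ l ∈ Finset.range (n + 1),
    (coeffₗ ((j : ℤ) - l)).smulRight (fourierLp 1 ((j : ℤ) - l))

theorem fejerₗ_apply (n : ℕ) (h : L1 ℂ) : fejerₗ n h = ((n : ℂ) + 1)⁻¹ •
    ∑ j ∈ Finset.range (n + 1), ∑ l ∈ Finset.range (n + 1),
      fourierCoeff h ((j : ℤ) - l) • (fourierLp 1 ((j : ℤ) - l) : L1 ℂ) := by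
  simp only [fejerₗ, LinearMap.smul_apply, LinearMap.sum_apply, LinearMap.smulRight_apply,
    coeffₗ_apply]

theorem continuous_fejerKernel (n : ℕ) : Continuous (fejerKernel n) := by
  unfold fejerKernel
  fun_prop

theorem fejerKernel_nonneg (n : ℕ) (θ : Torus) : 0 ≤ fejerKernel n θ := by
  unfold fejerKernel
  positivity

theorem ofReal_fejerKernel (n : ℕ) (θ : Torus) : (fejerKernel n θ : ℂ) = ((n : ℂ) + 1)⁻¹ *
    ∑ j ∈ Finset.range (n + 1), ∑ l ∈ Finset.range (n + 1), fourier ((j : ℤ) - l) θ := by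
  have h : ((‖∑ j ∈ Finset.range (n + 1), fourier (j : ℤ) θ‖ ^ 2 : ℝ) : ℂ) =
      ∑ j ∈ Finset.range (n + 1), ∑ l ∈ Finset.range (n + 1), fourier ((j : ℤ) - l) θ := by
    rw [Complex.ofReal_pow, ← Complex.mul_conj', map_sum, Finset.sum_mul_sum]
    refine Finset.sum_congr rfl fun j _ => Finset.sum_congr rfl fun l _ => ?_
    rw [sub_eq_add_neg, fourier_add, fourier_neg]
  rw [fejerKernel, Complex.ofReal_div, h]
  push_cast
  rw [div_eq_inv_mul]

/-- The factor counts the pairs `j, l ≤ n` with `j - l = m`. The truncated subtraction gives `0`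
when `m > n`, as it should. -/
theorem fejerₗ_fourierLp (n m : ℕ) : fejerₗ n (fourierLp 1 (m : ℤ)) =
    (((n : ℂ) + 1)⁻¹ * ((n + 1 - m : ℕ) : ℂ)) • (fourierLp 1 (m : ℤ) : L1 ℂ) := by
  have h : ∀ j l : ℕ, fourierCoeff (fourierLp 1 (m : ℤ) : L1 ℂ) ((j : ℤ) - l) •
      (fourierLp 1 ((j : ℤ) - l) : L1 ℂ) =
      if j = l + m then (fourierLp 1 (m : ℤ) : L1 ℂ) else 0 := by
    intro j l
    rw [fourierCoeff_congr_ae (coeFn_fourierLp 1 _), fourierCoeff_fourier]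
    split_ifs with hjl
    · have : (j : ℤ) - l = m := by omega
      rw [this, Pi.single_eq_same, one_smul]
    · rw [Pi.single_eq_of_ne (by omega), zero_smul]
  rw [fejerₗ_apply, Finset.sum_comm, mul_smul]
  congr 1
  simp only [h, Finset.sum_ite_eq', Finset.mem_range]
  rw [← Finset.sum_filter, Finset.sum_const, ← Nat.cast_smul_eq_nsmul ℂ]
  congr 2
  rw [← Finset.card_range (n + 1 - m)]
  congr 1
  ext l
  simp only [Finset.mem_filter, Finset.mem_range]
  omega

theorem integral_fejerKernel (n : ℕ) :
    ∫ θ, fejerKernel n θ ∂(AddCircle.haarAddCircle : Measure Torus) = 1 := by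
  have h0 : ∀ k : ℤ, ∫ θ, fourier k θ ∂(AddCircle.haarAddCircle : Measure Torus) =
      if k = 0 then 1 else 0 := fun k => by
    have := congrFun (fourierCoeff_fourier (T := 2 * π) k) 0
    rw [fourierCoeff] at this
    simp only [neg_zero, fourier_zero, one_smul] at this
    rw [this, Pi.single_apply]
    simp only [eq_comm]
  have hi : ∀ k : ℤ, Integrable (fun θ => fourier k θ)
      (AddCircle.haarAddCircle : Measure Torus) := fun k =>
    (fourier k).continuous.integrable_of_hasCompactSupport
      (HasCompactSupport.of_compactSpace _)
  rw [← Complex.ofReal_inj, ← integral_complex_ofReal]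
  simp only [ofReal_fejerKernel]
  rw [integral_const_mul, integral_finsetSum _ fun j _ => integrable_finsetSum _ fun l _ => hi _]
  simp only [integral_finsetSum _ fun l _ => hi _, h0, sub_eq_zero, Nat.cast_inj]
  simp only [Finset.sum_ite_eq, Finset.mem_range]
  rw [Finset.sum_congr rfl fun j hj => if_pos (Finset.mem_range.1 hj)]
  simp only [Finset.sum_const, Finset.card_range, nsmul_eq_mul, mul_one]
  push_cast
  exact inv_mul_cancel₀ (Nat.cast_add_one_ne_zero n)

/-- The coefficient form shows finite rank and the action on monomials; this convolution form is
what yields the `L¹` contraction estimate. -/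
theorem coeFn_fejerₗ (n : ℕ) (h : L1 ℂ) : fejerₗ n h =ᵐ[AddCircle.haarAddCircle]
    fun θ => ∫ t, (fejerKernel n (θ - t) : ℂ) * h t ∂AddCircle.haarAddCircle := by
  have h1 : ∀ᵐ θ ∂(AddCircle.haarAddCircle : Measure Torus), ∀ k : ℤ,
      (fourierLp 1 k : L1 ℂ) θ = fourier k θ := ae_all_iff.2 fun k => coeFn_fourierLp 1 k
  have h2 : (fejerₗ n h : Torus → ℂ) =ᵐ[AddCircle.haarAddCircle] fun θ => ((n : ℂ) + 1)⁻¹ •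
    ∑ j ∈ Finset.range (n + 1), ∑ l ∈ Finset.range (n + 1),
      fourierCoeff h ((j : ℤ) - l) • (fourierLp 1 ((j : ℤ) - l) : L1 ℂ) θ := by
    rw [fejerₗ_apply]
    have h3 : ∀ᵐ θ ∂(AddCircle.haarAddCircle : Measure Torus), ∀ k : ℤ,
        (fourierCoeff h k • (fourierLp 1 k : L1 ℂ) : L1 ℂ) θ =
          fourierCoeff h k • (fourierLp 1 k : L1 ℂ) θ := ae_all_iff.2 fun k => Lp.coeFn_smul _ _
    have h4 : ∀ᵐ θ ∂(AddCircle.haarAddCircle : Measure Torus), ∀ j : ℕ,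
        (∑ l ∈ Finset.range (n + 1), fourierCoeff h ((j : ℤ) - l) •
          (fourierLp 1 ((j : ℤ) - l) : L1 ℂ) : L1 ℂ) θ =
        ∑ l ∈ Finset.range (n + 1), (fourierCoeff h ((j : ℤ) - l) •
          (fourierLp 1 ((j : ℤ) - l) : L1 ℂ) : L1 ℂ) θ :=
      ae_all_iff.2 fun j => Lp.coeFn_fun_finsetSum _ _
    filter_upwards [h3, h4, Lp.coeFn_smul ((n : ℂ) + 1)⁻¹ (∑ j ∈ Finset.range (n + 1),
      ∑ l ∈ Finset.range (n + 1), fourierCoeff h ((j : ℤ) - l) •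
        (fourierLp 1 ((j : ℤ) - l) : L1 ℂ)), Lp.coeFn_fun_finsetSum (Finset.range (n + 1))
      fun j : ℕ => (∑ l ∈ Finset.range (n + 1), fourierCoeff h ((j : ℤ) - l) •
        (fourierLp 1 ((j : ℤ) - l) : L1 ℂ) : L1 ℂ)] with θ h3 h4 h5 h6
    rw [h5, Pi.smul_apply, h6]
    simp only [h4, h3]
  filter_upwards [h1, h2] with θ h1 h2
  rw [h2]
  have hi : ∀ k : ℤ, Integrable (fun t => fourier k (θ - t) * h t) AddCircle.haarAddCircle := by
    intro k
    refine (L1.integrable_coeFn h).bdd_mul (c := 1) (by fun_prop) (ae_of_all _ fun t => ?_)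
    rw [fourier_apply, Circle.norm_coe]
  simp only [ofReal_fejerKernel, h1, mul_assoc, Finset.sum_mul]
  rw [integral_const_mul, integral_finsetSum _ fun j _ => integrable_finsetSum _ fun l _ => hi _]
  simp only [integral_finsetSum _ fun l _ => hi _, smul_eq_mul]
  congr 1
  refine Finset.sum_congr rfl fun j _ => Finset.sum_congr rfl fun l _ => ?_
  rw [fourierCoeff, ← integral_mul_const]
  congr 1
  ext t
  have : (fourier ((j : ℤ) - l) (θ - t) : ℂ) =
      fourier ((j : ℤ) - l) θ * fourier (-((j : ℤ) - l)) t := by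
    simp only [fourier_apply]
    rw [← Circle.coe_mul, ← AddCircle.toCircle_add, smul_sub, neg_smul, sub_eq_add_neg]
  rw [this, smul_eq_mul]
  ring

/-- Tonelli's theorem for the convolution: the kernel is nonnegative with integral one, and Haar
measure is translation invariant. -/
theorem norm_fejerₗ_le (n : ℕ) (h : L1 ℂ) : ‖fejerₗ n h‖ ≤ ‖h‖ := by
  let μ : Measure Torus := AddCircle.haarAddCircle
  have hK : ∀ t, ∫⁻ θ, ‖(fejerKernel n (θ - t) : ℂ)‖ₑ ∂μ = 1 := fun t => by
    rw [lintegral_sub_right_eq_self (μ := μ) (fun θ => ‖(fejerKernel n θ : ℂ)‖ₑ) t]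
    have h1 : ∀ θ, ‖(fejerKernel n θ : ℂ)‖ₑ = ENNReal.ofReal (fejerKernel n θ) := fun θ => by
      rw [← ofReal_norm, Complex.norm_real, Real.norm_of_nonneg (fejerKernel_nonneg n θ)]
    simp only [h1]
    rw [← ofReal_integral_eq_lintegral_ofReal
      ((continuous_fejerKernel n).integrable_of_hasCompactSupport
        (HasCompactSupport.of_compactSpace _)) (ae_of_all _ (fejerKernel_nonneg n)),
      integral_fejerKernel, ENNReal.ofReal_one]
  have hm : AEMeasurable (Function.uncurry fun θ t => ‖(fejerKernel n (θ - t) : ℂ)‖ₑ * ‖h t‖ₑ)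
      (μ.prod μ) := by
    have h1 : Continuous fun p : Torus × Torus => (fejerKernel n (p.1 - p.2) : ℂ) :=
      Complex.continuous_ofReal.comp ((continuous_fejerKernel n).comp (by fun_prop))
    exact h1.measurable.enorm.aemeasurable.mul
      (Lp.aestronglyMeasurable h).comp_snd.enorm
  rw [L1.norm_def, L1.norm_def]
  refine ENNReal.toReal_mono (L1.hasFiniteIntegral_coeFn h).ne ?_
  calc ∫⁻ θ, ‖fejerₗ n h θ‖ₑ ∂μ
      = ∫⁻ θ, ‖∫ t, (fejerKernel n (θ - t) : ℂ) * h t ∂μ‖ₑ ∂μ :=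
        lintegral_congr_ae ((coeFn_fejerₗ n h).fun_comp enorm)
    _ ≤ ∫⁻ θ, ∫⁻ t, ‖(fejerKernel n (θ - t) : ℂ)‖ₑ * ‖h t‖ₑ ∂μ ∂μ :=
        lintegral_mono fun θ => (enorm_integral_le_lintegral_enorm _).trans
          (lintegral_mono fun t => (enorm_mul _ _).le)
    _ = ∫⁻ t, ∫⁻ θ, ‖(fejerKernel n (θ - t) : ℂ)‖ₑ * ‖h t‖ₑ ∂μ ∂μ :=
        lintegral_lintegral_swap hm
    _ = ∫⁻ t, ‖h t‖ₑ ∂μ := by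
        refine lintegral_congr fun t => ?_
        rw [lintegral_mul_const' _ _ enorm_ne_top, hK, one_mul]

theorem tendsto_fejerₗ {p : L1 ℂ} (hp : p ∈ analyticPolynomials ℂ) :
    Filter.Tendsto (fun n => fejerₗ n p) Filter.atTop (nhds p) := by
  induction hp using Submodule.span_induction with
  | mem p hp =>
    obtain ⟨m, c, rfl⟩ := hp
    rw [vec_eq_smul]
    simp only [map_smul, fejerₗ_fourierLp]
    refine Filter.Tendsto.const_smul ?_ c
    have h1 : Filter.Tendsto (fun n : ℕ => ((1 - m * (1 / ((n : ℝ) + 1)) : ℝ) : ℂ)) Filter.atTop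
        (nhds ((1 - m * 0 : ℝ) : ℂ)) :=
      (Complex.continuous_ofReal.tendsto _).comp
        ((tendsto_one_div_add_atTop_nhds_zero_nat.const_mul _).const_sub _)
    have h2 : Filter.Tendsto (fun n : ℕ => ((n : ℂ) + 1)⁻¹ * ((n + 1 - m : ℕ) : ℂ)) Filter.atTop
        (nhds 1) := by
      rw [mul_zero, sub_zero, Complex.ofReal_one] at h1
      refine h1.congr' ?_
      filter_upwards [Filter.eventually_ge_atTop m] with n hn
      have : (n : ℂ) + 1 ≠ 0 := Nat.cast_add_one_ne_zero n
      rw [Nat.cast_sub (by omega)]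
      push_cast
      field_simp
    simpa using h2.smul_const (fourierLp 1 (m : ℤ) : L1 ℂ)
  | zero => simp
  | add p q _ _ hp hq => simpa only [map_add] using hp.add hq
  | smul c p _ hp => simpa only [map_smul] using hp.const_smul c

/-- The Fejér mean of order `n` as a contraction of `L¹`. -/
noncomputable def fejer (n : ℕ) : L1 ℂ →L[ℂ] L1 ℂ :=
  (fejerₗ n).mkContinuous 1 fun h => by
    rw [one_mul]
    exact norm_fejerₗ_le n h

theorem fejer_mem_H1 (n : ℕ) {h : L1 ℂ} (hh : h ∈ H1 ℂ) : fejer n h ∈ H1 ℂ := by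
  refine map_mem_closure (fejer n).continuous hh fun p hp => ?_
  have hle : analyticPolynomials ℂ ≤ (analyticPolynomials ℂ).comap (fejerₗ n) := by
    refine Submodule.span_le.2 ?_
    rintro _ ⟨k, c, rfl⟩
    refine Submodule.subset_span ⟨k, c * (((n : ℂ) + 1)⁻¹ * ((n + 1 - k : ℕ) : ℂ)), ?_⟩
    rw [vec_eq_smul, vec_eq_smul, map_smul, fejerₗ_fourierLp, smul_smul]
  exact hle hp

theorem finiteDimensional_range_fejerₗ (n : ℕ) :
    FiniteDimensional ℂ (LinearMap.range (fejerₗ n)) := by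
  let s : Set (L1 ℂ) := (fun p : ℕ × ℕ => (fourierLp 1 ((p.1 : ℤ) - p.2) : L1 ℂ)) ''
    (Finset.range (n + 1) ×ˢ Finset.range (n + 1) : Finset (ℕ × ℕ))
  have : FiniteDimensional ℂ (Submodule.span ℂ s) :=
    FiniteDimensional.span_of_finite ℂ ((Finset.finite_toSet _).image _)
  refine Submodule.finiteDimensional_of_le (S₂ := Submodule.span ℂ s) ?_
  rintro _ ⟨h, rfl⟩
  rw [fejerₗ_apply]
  exact Submodule.smul_mem _ _ (Submodule.sum_mem _ fun j hj => Submodule.sum_mem _ fun l hl =>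
    Submodule.smul_mem _ _ (Submodule.subset_span
      ⟨(j, l), Finset.mem_coe.2 (Finset.mk_mem_product hj hl), rfl⟩))

/-- `H¹` has the metric approximation property, with a sequence of contractions. -/
theorem exists_finiteRank_approx : ∃ R : ℕ → (H1 ℂ →L[ℂ] H1 ℂ), (∀ n, ‖R n‖ ≤ 1) ∧
    (∀ n, FiniteDimensional ℂ (LinearMap.range (R n).toLinearMap)) ∧
    ∀ h, Filter.Tendsto (fun n => R n h) Filter.atTop (nhds h) := by
  let R : ℕ → (H1 ℂ →L[ℂ] H1 ℂ) := fun n =>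
    ((fejer n).comp (H1 ℂ).subtypeL).codRestrict (H1 ℂ) fun h => fejer_mem_H1 n h.2
  have hR : ∀ n h, (R n h : L1 ℂ) = fejerₗ n h := fun n h => rfl
  refine ⟨R, fun n => ?_, fun n => ?_, fun h => ?_⟩
  · refine ContinuousLinearMap.opNorm_le_bound _ zero_le_one fun h => ?_
    rw [one_mul]
    exact norm_fejerₗ_le n h
  · have := finiteDimensional_range_fejerₗ n
    let f : LinearMap.range (R n).toLinearMap →ₗ[ℂ] LinearMap.range (fejerₗ n) :=
      ((H1 ℂ).subtype ∘ₗ (LinearMap.range (R n).toLinearMap).subtype).codRestrict _ (by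
        rintro ⟨_, h, rfl⟩
        exact ⟨h, rfl⟩)
    refine FiniteDimensional.of_injective f fun x y hxy => ?_
    have h : (f x : L1 ℂ) = f y := by rw [hxy]
    exact Subtype.ext (Subtype.ext h)
  · rw [tendsto_subtype_rng]
    simp only [hR]
    rw [Metric.tendsto_atTop]
    intro ε hε
    obtain ⟨p, hp, hhp⟩ := Metric.mem_closure_iff.1 h.2 (ε / 3) (by positivity)
    obtain ⟨N, hN⟩ := Metric.tendsto_atTop.1 (tendsto_fejerₗ hp) (ε / 3) (by positivity)
    refine ⟨N, fun n hn => ?_⟩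
    have h1 : dist (fejerₗ n (h : L1 ℂ)) (fejerₗ n p) ≤ dist (h : L1 ℂ) p := by
      rw [dist_eq_norm, dist_eq_norm, ← map_sub]
      exact norm_fejerₗ_le n _
    have h2 := dist_triangle4 (fejerₗ n (h : L1 ℂ)) (fejerₗ n p) p h
    have h3 := hN n hn
    rw [dist_comm p] at h2
    linarith

/-! ### Functionals on `L¹(X)`, operators into `X*`, and transfer between `X` and `X**` -/

open ProjAlg

variable {X : Type*} [NormedAddCommGroup X] [NormedSpace ℂ X]

/-- A functional `Φ` on `L¹(X)`, seen as the operator `h ↦ (x ↦ Φ (h x))` from `L¹` to `X*`. -/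
noncomputable def toOperator (Φ : StrongDual ℂ (L1 X)) : L1 ℂ →L[ℂ] StrongDual ℂ X :=
  ((vec X).compr₂ Φ.toLinearMap).mkContinuous₂ ‖Φ‖ fun h x => by
    rw [mul_assoc]
    exact (Φ.le_opNorm _).trans (by gcongr; exact norm_vec_le X h x)

theorem toOperator_apply (Φ : StrongDual ℂ (L1 X)) (h : L1 ℂ) (x : X) :
    toOperator Φ h x = Φ (vec X h x) := rfl

theorem norm_toOperator_le (Φ : StrongDual ℂ (L1 X)) : ‖toOperator Φ‖ ≤ ‖Φ‖ :=
  LinearMap.mkContinuous₂_norm_le _ (norm_nonneg _) _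

theorem vec_indicatorConstLp {s : Set Torus} (hs : MeasurableSet s)
    (hμ : (AddCircle.haarAddCircle : Measure Torus) s ≠ ∞) (c : ℂ) (x : X) :
    vec X (indicatorConstLp 1 hs hμ c) x = indicatorConstLp 1 hs hμ (c • x) := by
  apply Lp.ext
  filter_upwards [coeFn_vec X (indicatorConstLp 1 hs hμ c) x,
    indicatorConstLp_coeFn (p := 1) (hs := hs) (hμs := hμ) (c := c),
    indicatorConstLp_coeFn (p := 1) (hs := hs) (hμs := hμ) (c := c • x)] with θ h1 h2 h3
  rw [h1, h2, h3]
  by_cases h : θ ∈ s <;> simp [h]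

/-- An operator `A : L¹ → X*` defines a functional on `L¹(X)`. -/
theorem exists_functional_of_operator (A : L1 ℂ →L[ℂ] StrongDual ℂ X) :
    ∃ Ψ : L1 X →+ ℂ, (∀ f, ‖Ψ f‖ ≤ ‖A‖ * ‖f‖) ∧ ∀ h x, Ψ (vec X h x) = A h x := by
  classical
  let μ : Measure Torus := AddCircle.haarAddCircle
  -- The vector measure `s ↦ A 1_s`, dominated by `‖A‖` times Haar measure; the functional is
  -- integration against it.
  let T : Set Torus → X →L[ℝ] ℂ := fun s =>
    if hs : MeasurableSet s then
      (A (indicatorConstLp 1 hs (measure_ne_top μ s) 1)).restrictScalars ℝ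
    else 0
  have hT : ∀ {s} (hs : MeasurableSet s) x,
      T s x = A (indicatorConstLp 1 hs (measure_ne_top μ s) 1) x := fun hs x => by
    simp only [T, dif_pos hs]; rfl
  have hdom : DominatedFinMeasAdditive μ T ‖A‖ := by
    refine ⟨fun s t hs ht hμs hμt hst => ?_, fun s hs _ => ?_⟩
    · ext x
      rw [_root_.add_apply, hT hs, hT ht, hT (hs.union ht),
        ← _root_.add_apply, ← map_add,
        indicatorConstLp_disjoint_union hs ht hμs hμt hst]
    · refine ContinuousLinearMap.opNorm_le_bound _ (by positivity) fun x => ?_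
      rw [hT hs]
      refine (ContinuousLinearMap.le_opNorm _ _).trans ?_
      gcongr
      refine (A.le_opNorm _).trans ?_
      rw [norm_indicatorConstLp one_ne_zero ENNReal.one_ne_top]
      simp [μ]
  -- Additivity is enough, since values are only needed on finite sums of functions `vec X h x`.
  refine ⟨(L1.setToL1 hdom : L1 _ →+ ℂ), L1.norm_setToL1_le_mul_norm hdom (by positivity), ?_⟩
  intro h x
  have hvec : Continuous fun h : L1 ℂ => vec X h x :=
    ((ContinuousLinearMap.toSpanSingleton ℂ x).compLpL 1 μ).continuous
  refine Lp.induction ENNReal.one_ne_top (motive := fun h : L1 ℂ =>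
    L1.setToL1 hdom (vec X h x) = A h x) ?_ ?_ ?_ h
  · intro c s hs hμs
    have h1 : indicatorConstLp 1 hs hμs.ne c =
        c • indicatorConstLp 1 hs (measure_ne_top μ s) (1 : ℂ) := by
      apply Lp.ext
      filter_upwards [indicatorConstLp_coeFn (p := 1) (hs := hs) (hμs := hμs.ne) (c := c),
        indicatorConstLp_coeFn (p := 1) (hs := hs) (hμs := measure_ne_top μ s) (c := (1 : ℂ)),
        Lp.coeFn_smul c (indicatorConstLp 1 hs (measure_ne_top μ s) (1 : ℂ))] with θ h1 h2 h3
      rw [h1, h3, Pi.smul_apply, h2]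
      by_cases h : θ ∈ s <;> simp [h]
    rw [Lp.simpleFunc.coe_indicatorConst, vec_indicatorConstLp, L1.setToL1_indicatorConstLp,
      hT hs, h1, map_smul, map_smul, _root_.smul_apply]
  · intro f g hf hg _ h1 h2
    rw [map_add, map_add, LinearMap.add_apply, map_add, _root_.add_apply, h1, h2]
  · exact isClosed_eq ((L1.setToL1 hdom).continuous.comp hvec) (by fun_prop)

/-- A functional on `L¹(X)` extends canonically to `L¹(X**)`, with the same bound. -/
theorem exists_bidual_extension (Φ : StrongDual ℂ (L1 X)) :
    ∃ Ψ : L1 (StrongDual ℂ (StrongDual ℂ X)) →+ ℂ, (∀ f, ‖Ψ f‖ ≤ ‖Φ‖ * ‖f‖) ∧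
      ∀ h ξ, Ψ (vec _ h ξ) = ξ (toOperator Φ h) := by
  obtain ⟨Ψ, h1, h2⟩ := exists_functional_of_operator (X := StrongDual ℂ (StrongDual ℂ X))
    ((NormedSpace.inclusionInDoubleDual ℂ (StrongDual ℂ X)).comp (toOperator Φ))
  refine ⟨Ψ, fun f => (h1 f).trans ?_, h2⟩
  gcongr
  refine (ContinuousLinearMap.opNorm_comp_le _ _).trans ((mul_le_of_le_one_left (norm_nonneg _)
    (NormedSpace.inclusionInDoubleDual_norm_le ℂ _)).trans (norm_toOperator_le Φ))

/-- The pairing with operators `H¹ → X*` on `H¹ ⊗ X**` is controlled by the `L¹(X**)`-norm, if the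
projective norm on `H¹ ⊗ X` is controlled by the `L¹(X)`-norm. -/
theorem norm_pairing_le_of_norm_le {c : ℝ} (hc0 : 0 ≤ c)
    (hc : ∀ u : ProjAlg (H1 ℂ) X, ‖u‖ ≤ c * ‖algInclusion X u‖)
    (S : H1 ℂ →L[ℂ] StrongDual ℂ X) (u : ProjAlg (H1 ℂ) (StrongDual ℂ (StrongDual ℂ X))) :
    ‖pairing S u‖ ≤ c * ‖algInclusion _ u‖ * ‖S‖ := by
  let B : H1 ℂ →ₗ[ℂ] X →ₗ[ℂ] ℂ := (ContinuousLinearMap.coeLM ℂ).comp S.toLinearMap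
  have hB : ∀ h x, lift B (tmul h x) = S h x := fun h x => lift_tmul _ _ _
  have h1 : ∀ a, ‖lift B a‖ ≤ ‖S‖ * c * ‖((H1 X).subtype ∘ₗ algInclusion X) a‖ := fun a =>
    calc ‖lift B a‖ ≤ ‖S‖ * ‖a‖ := norm_lift_le B (norm_nonneg S) (fun h x =>
          ((S h).le_opNorm x).trans (by
            rw [← mul_assoc]
            gcongr
            exact S.le_opNorm h)) a
      _ ≤ ‖S‖ * (c * ‖algInclusion X a‖) := by gcongr; exact hc a
      _ = _ := (mul_assoc _ _ _).symm
  -- The factorization is through all of `L¹(X)`, not just the Hardy space: extending to `L¹(X**)`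
  -- needs an operator defined on indicator functions.
  obtain ⟨Φ, hΦ, hΦ'⟩ := exists_dual_comp_eq _ (lift B) (by positivity) h1
  obtain ⟨Ψ, hΨ, hΨ'⟩ := exists_bidual_extension Φ
  have h2 : ∀ h : H1 ℂ, toOperator Φ h = S h := fun h => by
    ext x
    rw [toOperator_apply, ← hB, ← hΦ']
    rfl
  have h3 : Ψ (algInclusion _ u) = pairing S u := by
    refine induction_on (p := fun u => Ψ (algInclusion _ u) = pairing S u) u (by simp) ?_ ?_
    · intro h ξ
      rw [algInclusion_tmul, hΨ', pairing_tmul, h2]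
    · intro u v hu hv
      rw [map_add, map_add, Submodule.coe_add, map_add, hu, hv]
  rw [← h3]
  calc _ ≤ ‖Φ‖ * ‖algInclusion _ u‖ := hΨ _
    _ ≤ ‖S‖ * c * ‖algInclusion _ u‖ := by gcongr
    _ = _ := by ring

/-- A bound for the projective norm of `H¹ ⊗ X` passes to `H¹ ⊗ X**`. -/
theorem norm_le_bidual {c : ℝ} (hc0 : 0 ≤ c)
    (hc : ∀ u : ProjAlg (H1 ℂ) X, ‖u‖ ≤ c * ‖algInclusion X u‖)
    (u : ProjAlg (H1 ℂ) (StrongDual ℂ (StrongDual ℂ X))) : ‖u‖ ≤ c * ‖algInclusion _ u‖ := by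
  obtain ⟨R, hR1, hRf, hRt⟩ := exists_finiteRank_approx
  refine le_of_tendsto (tendsto_mapLeft hRt u).norm (Filter.Eventually.of_forall fun n => ?_)
  exact norm_mapLeft_le_of_forall_pairing (R n) (hR1 n) (hRf n) u (by positivity) fun S =>
    norm_pairing_le_of_norm_le hc0 hc S u

theorem norm_algInclusion_mapRight {Y : Type*} [NormedAddCommGroup Y] [NormedSpace ℂ Y]
    (j : X →L[ℂ] Y) (hj : ∀ x, ‖j x‖ = ‖x‖) (u : ProjAlg (H1 ℂ) X) :
    ‖algInclusion Y (mapRight j u)‖ = ‖algInclusion X u‖ := by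
  have h1 : (H1 Y).subtype ∘ₗ algInclusion Y ∘ₗ mapRight j =
      (j.compLpL 1 AddCircle.haarAddCircle).toLinearMap ∘ₗ (H1 X).subtype ∘ₗ algInclusion X := by
    refine hom_ext fun h x => ?_
    simp only [LinearMap.comp_apply, mapRight_tmul, Submodule.subtype_apply, algInclusion_tmul]
    apply Lp.ext
    filter_upwards [coeFn_vec Y h (j x), coeFn_vec X h x, j.coeFn_compLp (vec X h x)]
      with θ h1 h2 h3
    refine h1.trans (Eq.symm (h3.trans ?_))
    rw [h2, map_smul]
  have h2 : (algInclusion Y (mapRight j u) : L1 Y) = j.compLp (algInclusion X u : L1 X) :=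
    LinearMap.congr_fun h1 u
  rw [Submodule.coe_norm, Submodule.coe_norm, h2]
  refine le_antisymm (Lp.norm_le_norm_of_ae_le ?_) (Lp.norm_le_norm_of_ae_le ?_) <;>
  · filter_upwards [j.coeFn_compLp (algInclusion X u : L1 X)] with θ h
    rw [h, hj]

/-- A bound for the projective norm of `H¹ ⊗ X**` passes to `H¹ ⊗ X`. -/
theorem norm_le_of_bidual {c : ℝ}
    (hc : ∀ u : ProjAlg (H1 ℂ) (StrongDual ℂ (StrongDual ℂ X)), ‖u‖ ≤ c * ‖algInclusion _ u‖)
    (u : ProjAlg (H1 ℂ) X) : ‖u‖ ≤ c * ‖algInclusion X u‖ := by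
  rw [← norm_algInclusion_mapRight (Y := StrongDual ℂ (StrongDual ℂ X)) (NormedSpace.inclusionInDoubleDual ℂ X)
    (NormedSpace.inclusionInDoubleDualLi ℂ (E := X)).norm_map u]
  exact (norm_le_mapRight_bidual u).trans (hc _)

/-! ### Passage to the completion, injectivity, and projectivity as finiteness of the constant -/

theorem forall_projTensor_norm_le_iff [CompleteSpace X] (c : ℝ) :
    (∀ F : ProjTensor (H1 ℂ) X, ‖F‖ ≤ c * ‖inclusion X F‖) ↔
      ∀ u : ProjAlg (H1 ℂ) X, ‖u‖ ≤ c * ‖algInclusion X u‖ := by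
  refine ⟨fun h u => ?_, fun h F => ?_⟩
  · rw [← inclusion_coe, ← UniformSpace.Completion.norm_coe]
    exact h u
  · refine UniformSpace.Completion.induction_on F (isClosed_le (by fun_prop) (by fun_prop))
      fun u => ?_
    rw [inclusion_coe, UniformSpace.Completion.norm_coe]
    exact h u

/-- The bound is in the `L¹(X)` norm, which is weaker than the projective one. Extend `φ` to `L¹`
and norm the slice by `g ∈ X*`: the value is then the extension applied to the scalar function
obtained by composing with `g`. -/
theorem norm_slice_le (φ : StrongDual ℂ (H1 ℂ)) (u : ProjAlg (H1 ℂ) X) :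
    ‖slice φ u‖ ≤ ‖φ‖ * ‖algInclusion X u‖ := by
  obtain ⟨φ', h1, h2⟩ := exists_extension_norm_eq _ φ
  obtain ⟨g, hg, hgu⟩ := exists_dual_vector'' ℂ (slice φ u)
  have h3 : g.toLinearMap ∘ₗ slice φ = φ'.toLinearMap ∘ₗ
      (g.compLpL 1 AddCircle.haarAddCircle).toLinearMap ∘ₗ (H1 X).subtype ∘ₗ algInclusion X := by
    refine hom_ext fun h x => ?_
    have : g.compLp (vec X h x) = g x • (h : L1 ℂ) := by
      apply Lp.ext
      filter_upwards [g.coeFn_compLp (vec X h x), coeFn_vec X h x,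
        Lp.coeFn_smul (g x) (h : L1 ℂ)] with θ h1 h2 h3
      rw [h1, h2, h3, map_smul, smul_eq_mul, Pi.smul_apply, smul_eq_mul, mul_comm]
    simp only [LinearMap.comp_apply, slice_tmul, Submodule.subtype_apply, algInclusion_tmul]
    refine Eq.trans ?_ (congrArg φ' this).symm
    refine (map_smul g _ _).trans (Eq.trans ?_ (map_smul φ' _ _).symm)
    rw [smul_eq_mul, smul_eq_mul, mul_comm]
    exact congrArg (g x * ·) (h1 h).symm
  calc ‖slice φ u‖ = ‖g (slice φ u)‖ := by rw [hgu]; simp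
    _ = ‖φ' (g.compLp (algInclusion X u : L1 X))‖ := congrArg norm (LinearMap.congr_fun h3 u)
    _ ≤ ‖φ'‖ * ‖g.compLp (algInclusion X u : L1 X)‖ := φ'.le_opNorm _
    _ ≤ ‖φ'‖ * (1 * ‖(algInclusion X u : L1 X)‖) := by
        gcongr
        exact (g.norm_compLp_le _).trans (by gcongr)
    _ = _ := by rw [h2, one_mul, Submodule.coe_norm]

/-- A finite-rank operator only sees finitely many slices, each controlled by the `L¹(X)` norm. The
constant depends on `R`; it serves only to prove injectivity. -/
theorem exists_norm_mapLeft_le (R : H1 ℂ →L[ℂ] H1 ℂ)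
    (hR : FiniteDimensional ℂ (LinearMap.range R.toLinearMap)) :
    ∃ K : ℝ, ∀ u : ProjAlg (H1 ℂ) X, ‖mapLeft R u‖ ≤ K * ‖algInclusion X u‖ := by
  let V := LinearMap.range R.toLinearMap
  let R' : H1 ℂ →L[ℂ] V := R.codRestrict V fun x => LinearMap.mem_range_self _ x
  let b := Module.finBasis ℂ V
  let φ := fun i => (LinearMap.toContinuousLinearMap (b.coord i)).comp R'
  refine ⟨∑ i, ‖(b i : H1 ℂ)‖ * ‖φ i‖, fun u => ?_⟩
  rw [mapLeft_eq_sum_slice R φ (fun i => (b i : H1 ℂ)) (fun x => ?_), Finset.sum_mul]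
  · refine norm_sum_le_of_le _ fun i _ => (norm_tmul_le _ _).trans ?_
    rw [mul_assoc]
    gcongr
    exact norm_slice_le _ u
  · have := congrArg V.subtype (b.sum_repr (R' x))
    rw [map_sum] at this
    exact this.symm

variable [CompleteSpace X]

/-- If `F` is in the kernel, tensors near `F` have small image, hence small `(R n ⊗ id)`-image for
fixed `n`; but `R n ⊗ id` is a contraction that nearly fixes a tensor close to `F`. -/
theorem inclusion_injective : Function.Injective (inclusion X) := by
  rw [injective_iff_map_eq_zero]
  intro F hF
  obtain ⟨R, hR1, hRf, hRt⟩ := exists_finiteRank_approx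
  rw [← norm_le_zero_iff]
  refine le_of_forall_pos_le_add fun ε hε => ?_
  have hδ : 0 < ε / 8 := by positivity
  obtain ⟨u₀, hu₀⟩ := UniformSpace.Completion.denseRange_coe.exists_dist_lt F hδ
  obtain ⟨n, hn⟩ := ((tendsto_iff_norm_sub_tendsto_zero.1
    (tendsto_mapLeft hRt u₀)).eventually (gt_mem_nhds hδ)).exists
  obtain ⟨K, hK⟩ := exists_norm_mapLeft_le (X := X) (R n) (hRf n)
  -- The rank-dependent constant `K` is fixed before `u` is chosen, so continuity at `F`, where the
  -- inclusion vanishes, absorbs it.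
  obtain ⟨u, hu, huK⟩ := UniformSpace.Completion.denseRange_coe.exists_mem_open
    (s := {G : ProjTensor (H1 ℂ) X | dist F G < ε / 8} ∩ {G | K * ‖inclusion X G‖ < ε / 8})
    ((isOpen_lt (by fun_prop) (by fun_prop)).inter (isOpen_lt (by fun_prop) (by fun_prop)))
    ⟨F, by simpa using hδ, by simpa [hF] using hδ⟩
  simp only [Set.mem_ofPred_eq, inclusion_coe] at hu huK
  have h1 : ‖u - u₀‖ < ε / 8 + ε / 8 := by
    rw [← UniformSpace.Completion.norm_coe, UniformSpace.Completion.coe_sub, ← dist_eq_norm]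
    exact (dist_triangle_left _ _ F).trans_lt (add_lt_add hu hu₀)
  have h2 : ‖mapLeft (R n) (u - u₀)‖ ≤ ‖u - u₀‖ :=
    (norm_mapLeft_le _ _).trans (mul_le_of_le_one_left (norm_nonneg (u - u₀)) (hR1 n))
  have h3 : ‖u‖ ≤ ‖mapLeft (R n) u‖ + (‖u - u₀‖ + ‖mapLeft (R n) (u - u₀)‖ +
      ‖mapLeft (R n) u₀ - u₀‖) := by
    have : u = mapLeft (R n) u + ((u - u₀) - mapLeft (R n) (u - u₀) -
        (mapLeft (R n) u₀ - u₀)) := by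
      rw [map_sub]; abel
    conv_lhs => rw [this]
    refine (norm_add_le _ _).trans (add_le_add_right ?_ _)
    exact (norm_sub_le _ _).trans (add_le_add_left (norm_sub_le _ _) _)
  have h4 : ‖F‖ ≤ dist F u + ‖u‖ := by
    rw [← UniformSpace.Completion.norm_coe u, dist_eq_norm]
    simpa using norm_add_le (F - u) (u : ProjTensor (H1 ℂ) X)
  have h5 := hK u
  -- The errors total less than `7ε/8`: three terms below `ε / 8` and two below `ε / 4`.
  linarith

theorem fourierLp_mem_H1 (k : ℕ) : (fourierLp 1 (k : ℤ) : L1 ℂ) ∈ H1 ℂ := by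
  refine subset_closure (Submodule.subset_span ⟨k, 1, ?_⟩)
  apply Lp.ext
  filter_upwards [coeFn_vec ℂ (fourierLp 1 (k : ℤ)) 1] with θ h
  rw [h, smul_eq_mul, mul_one]

theorem denseRange_inclusion : DenseRange (inclusion X) := by
  rw [DenseRange, Subtype.dense_iff]
  have h : analyticPolynomials X ≤
      (LinearMap.range (inclusion X).toLinearMap).map (H1 X).subtype := by
    refine Submodule.span_le.2 ?_
    rintro _ ⟨k, x, rfl⟩
    exact ⟨_, ⟨(tmul ⟨_, fourierLp_mem_H1 k⟩ x : ProjAlg (H1 ℂ) X), rfl⟩,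
      congrArg Subtype.val (inclusion_coe X _)⟩
  refine fun f hf => closure_mono ?_ hf
  exact h

/-- A surjective inclusion is bijective, and the norm of its inverse is an admissible constant.
Conversely, a finite constant bounds the inclusion below, so its range is closed as well as dense.
-/
theorem isH1Projective_iff : IsH1Projective X ↔ eta X ≠ ∞ := by
  constructor
  · intro h
    let e := ContinuousLinearEquiv.ofBijective (inclusion X)
      (LinearMap.ker_eq_bot.2 inclusion_injective) (LinearMap.range_eq_top.2 h)
    refine ((iInf₂_le ‖(e.symm : H1 X →L[ℂ] ProjTensor (H1 ℂ) X)‖₊ fun F => ?_).trans_lt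
      ENNReal.coe_lt_top).ne
    have := (e.symm : H1 X →L[ℂ] ProjTensor (H1 ℂ) X).le_opNorm (e F)
    simpa [e] using this
  · intro h
    have h1 : AntilipschitzWith (eta X).toNNReal (inclusion X) :=
      AddMonoidHomClass.antilipschitz_of_bound _ (norm_le_eta X h)
    have h2 := (h1.isClosed_range (inclusion X).uniformContinuous).closure_eq
    rw [denseRange_inclusion.closure_range] at h2
    exact Set.range_eq_univ.1 h2.symm

end Hardy

theorem corollary2p6 (X : Type*) [NormedAddCommGroup X] [NormedSpace ℂ X] [CompleteSpace X] :
    (Hardy.IsH1Projective X ↔ Hardy.IsH1Projective (StrongDual ℂ (StrongDual ℂ X))) ∧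
      Hardy.eta X = Hardy.eta (StrongDual ℂ (StrongDual ℂ X)) := by
  have h : Hardy.eta X = Hardy.eta (StrongDual ℂ (StrongDual ℂ X)) := by
    unfold Hardy.eta
    refine iInf_congr fun c => iInf_congr_Prop ?_ fun _ => rfl
    rw [Hardy.forall_projTensor_norm_le_iff, Hardy.forall_projTensor_norm_le_iff]
    exact ⟨Hardy.norm_le_bidual c.2, Hardy.norm_le_of_bidual⟩
  exact ⟨by rw [Hardy.isH1Projective_iff, Hardy.isH1Projective_iff, h], h⟩
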